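/- Let $(Y,\|\cdot\|)$ be a real normed space of dimension at least $2$ with topological dual $Y^*$. A set $C\subseteq Y$ is a cone if $0\in C=\mathbb R_+\cdot C$; it is nontrivial if $\{0\}\ne C\ne Y$. Put $\ell(C):=C\cap(-C)$. For a norm $\psi$ on $Y$ and a cone $C$ put $B_C(\psi):=\{y\in C\mid\psi(y)=1\}$, $S_C(\psi):=\operatorname{conv}B_C(\psi)$, $C_\psi(x^*,\alpha):=\{y\in Y\mid x^*(y)\ge\alpha\psi(y)\}$ for $x^*\in Y^*$, $\alpha\ge 0$, and $$C^{a\#}(\psi):=\{(x^*,\alpha)\in Y^*\times\mathbb R_+\mid \forall y\in C\setminus\{0\}:\ x^*(y)>0\text{ and }x^*(y)-\alpha\psi(y)>0\}.$$ Let $\Omega$ be a nonempty feasible set in a real topological vector space $X$ and $f:X\to Y$. For a cone $C$, $\operatorname{Eff}(\Omega\mid f,C)$ is the set of $\bar x\in\Omega$ for which there is no $x\in\Omega$ with $f(x)\in f(\bar x)-C\setminus\{0\}$. For a map $\mathbb A:\Omega\to 2^Y$ whose values are cones, $\operatorname{PEff}_{\mathbb A}(\Omega\mid f,C)$ is the set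 of $\bar x\in\operatorname{Eff}(\Omega\mid f,C)$ with $\mathbb A(\bar x)\cap(-C)=\{0\}$. Let $K\subseteq Y$ be a nontrivial, closed, convex cone with $0\notin\operatorname{cl}S_{-K}(\|\cdot\|)$, let $\bar x\in\operatorname{PEff}_{\mathbb A}(\Omega\mid f,K)$, and suppose that $A:=\mathbb A(\bar x)$ satisfies $\{0\}\ne f[\Omega]-f(\bar x)\subseteq A$. Assume that one of the following holds ($\operatorname{cl}_w$ denotes weak closure): a) $B_A(\|\cdot\|)$ and $\operatorname{cl}S_{-K}(\|\cdot\|)$ are compact; b) $A$ is weakly closed, and either $Y$ is reflexive, or $\operatorname{cl}S_{-K}(\|\cdot\|)$ and $\operatorname{cl}_wB_A(\|\cdot\|)$ are weakly compact and $0\notin\operatorname{cl}_wB_A(\|\cdot\|)$. Then there are a norm $\|\cdot\|'$ on $Y$ equivalent to $\|\cdot\|$ and a pair $(x^*,\alpha)\in K^{a\#}(\|\cdot\|')$ with $\alpha>0$ such that, with $C:=C_{\|\cdot\|'}(x^*,\alpha)$, $\bar x\in\operatorname{Eff}(\Omega\mid f,C)$. Moreover, for every sublinear $\varphi:Y\to\mathbb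 R$ with $\varphi(0)=0$ and $-C=\{y\in Y\mid\varphi(y)\le 0\}$, the following hold, where $(P_\varphi^{a,k})$ is the problem of minimizing $\lambda$ subject to $(x,\lambda)\in\Omega\times\mathbb R$, $\varphi(f(x)-a-\lambda k)\le 0$: 1) for every $k\in C\setminus\ell(C)$, the set of solutions of $(P_\varphi^{a,k})$ with $a=f(\bar x)$ is $\{(x,0)\mid x\in\Omega,\ f(x)=f(\bar x)\}$; 2) $\{x\in\Omega\mid f(x)=f(\bar x)\}=\operatorname{argmin}_{x\in\Omega}\varphi(f(x)-f(\bar x))$; 3) for all sets $\mathcal P\subseteq Y$, $\mathcal T\subseteq C\setminus\ell(C)$, $\mathcal R\subseteq\mathbb R$ with $f[\operatorname{Eff}(\Omega\mid f,C)]\subseteq\mathcal P+\mathcal R\cdot\mathcal T$: there are $a\in\mathcal P$, $k\in\mathcal T$, $s\in\mathcal R$ such that $\{(x,s)\mid x\in\Omega,\ f(x)=f(\bar x)\}$ is the set of solutions of $(P_\varphi^{a,k})$; and there are $a\in\mathcal P$, $k\in\mathcal T$, $s\in\mathcal R$ such that $\varphi^G_{a-C,k}(f(\bar x))=s$ and $\{x\in\Omega\mid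 f(x)=f(\bar x)\}=\operatorname{argmin}_{x\in\Omega}\varphi^G_{a-C,k}(f(x))$, where $\varphi^G_{a-C,k}(y):=\inf\{t\in\mathbb R\mid y\in tk+(a-C)\}\in\mathbb R\cup\{\pm\infty\}$. -/

import Mathlib

open scoped Pointwise

namespace BPScal

section Cones

variable {Y : Type*} [AddCommGroup Y] [Module ℝ Y]

/-- A cone: `0 ∈ K = ℝ₊ · K` (no convexity). -/
def IsCone (K : Set Y) : Prop :=
  (0 : Y) ∈ K ∧ Set.Ici (0 : ℝ) • K = K

/-- A cone is nontrivial if `{0} ≠ K ≠ Y`. -/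
def IsNontrivialCone (K : Set Y) : Prop :=
  IsCone K ∧ K ≠ {0} ∧ K ≠ Set.univ

/-- `ℓ(K) = K ∩ (-K)`. -/
def lineality (K : Set Y) : Set Y := K ∩ (-K)

/-- `B_K(ψ) = {x ∈ K | ψ(x) = 1}`. -/
def normBase (K : Set Y) (ψ : Seminorm ℝ Y) : Set Y := {x ∈ K | ψ x = 1}

/-- `S_K(ψ) = conv B_K(ψ)`. -/
def convBase (K : Set Y) (ψ : Seminorm ℝ Y) : Set Y := convexHull ℝ (normBase K ψ)

/-- `φ` is sublinear: positively homogeneous and subadditive. -/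
def IsSublinear (φ : Y → ℝ) : Prop :=
  (∀ (t : ℝ) (y : Y), 0 ≤ t → φ (t • y) = t * φ y) ∧ ∀ y z : Y, φ (y + z) ≤ φ y + φ z

/-- `φ` is `-C` representing: `-C = {y | φ(y) ≤ 0}`. -/
def IsNegRepresenting (φ : Y → ℝ) (C : Set Y) : Prop := -C = {y | φ y ≤ 0}

end Cones

section Normed

variable {Y : Type*} [NormedAddCommGroup Y] [NormedSpace ℝ Y]

/-- `p` is a norm equivalent to the given norm of `Y` (the lower bound makes the seminorm `p`
a norm). -/
def IsEquivalentNorm (p : Seminorm ℝ Y) : Prop :=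
  ∃ c C : ℝ, 0 < c ∧ 0 < C ∧ ∀ y : Y, c * ‖y‖ ≤ p y ∧ p y ≤ C * ‖y‖

/-- `C_ψ(x*, α) = {y | x*(y) ≥ α ψ(y)}`. -/
def bpCone (ψ : Seminorm ℝ Y) (xs : StrongDual ℝ Y) (α : ℝ) : Set Y :=
  {y | α * ψ y ≤ xs y}

/-- `K^# = {y* | y*(k) > 0 for all k ∈ K \ {0}}`. -/
def quasiDual (K : Set Y) : Set (StrongDual ℝ Y) := {xs | ∀ k ∈ K \ {0}, 0 < xs k}

/-- `K^{a#}(ψ)`. -/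
def augQuasiDual (K : Set Y) (ψ : Seminorm ℝ Y) : Set (StrongDual ℝ Y × ℝ) :=
  {q | q.1 ∈ quasiDual K ∧ 0 ≤ q.2 ∧ ∀ y ∈ K \ {0}, 0 < q.1 y - q.2 * ψ y}

/-- Reflexivity: the canonical embedding into the bidual is onto. -/
def IsReflexive (Y : Type*) [NormedAddCommGroup Y] [NormedSpace ℝ Y] : Prop :=
  Function.Surjective (NormedSpace.inclusionInDoubleDual ℝ Y)

def IsWeaklyClosed (S : Set Y) : Prop := IsClosed (toWeakSpace ℝ Y '' S)

def IsWeaklyCompact (S : Set Y) : Prop := IsCompact (toWeakSpace ℝ Y '' S)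

/-- The weak closure, as a subset of `Y`. -/
def weakClosure (S : Set Y) : Set Y := toWeakSpace ℝ Y ⁻¹' closure (toWeakSpace ℝ Y '' S)

end Normed

section Optimization

variable {X Y : Type*} [AddCommGroup Y] [Module ℝ Y]

/-- `Eff(Ω | f, K)`: no `x ∈ Ω` satisfies `f(x) ∈ f(x̄) - K \ {0}`. -/
def Eff (Ω : Set X) (f : X → Y) (K : Set Y) : Set X :=
  {xb ∈ Ω | ¬ ∃ x ∈ Ω, f xb - f x ∈ K \ {0}}

/-- `PEff_𝔸(Ω | f, K)`; only the values of `𝔸` on `Ω` matter. -/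
def PEff (𝔸 : X → Set Y) (Ω : Set X) (f : X → Y) (K : Set Y) : Set X :=
  {xb ∈ Eff Ω f K | 𝔸 xb ∩ (-K) = {0}}

/-- The set of minimizers of `g` over `Ω`. -/
def argmin {β : Type*} [LE β] (Ω : Set X) (g : X → β) : Set X :=
  {x ∈ Ω | ∀ x' ∈ Ω, g x ≤ g x'}

/-- Feasible pairs of the problem: minimize `λ` subject to `φ(f(x) - a - λ k) ≤ 0`,
`(x, λ) ∈ Ω × ℝ`. -/
def psFeasible (Ω : Set X) (f : X → Y) (φ : Y → ℝ) (a k : Y) : Set (X × ℝ) :=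
  {q | q.1 ∈ Ω ∧ φ (f q.1 - a - q.2 • k) ≤ 0}

/-- Solutions of the problem: minimize `λ` subject to `φ(f(x) - a - λ k) ≤ 0`,
`(x, λ) ∈ Ω × ℝ`. -/
def psSolutions (Ω : Set X) (f : X → Y) (φ : Y → ℝ) (a k : Y) : Set (X × ℝ) :=
  argmin (psFeasible Ω f φ a k) Prod.snd

/-- Gerstewitz function `φ^G_{a-C,k}(y) = inf {t ∈ ℝ | y ∈ t k + (a - C)}`, with values in the
extended reals. -/
noncomputable def gerstewitz (a : Y) (C : Set Y) (k y : Y) : EReal :=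
  sInf {r : EReal | ∃ t : ℝ, t • k + a - y ∈ C ∧ r = (t : EReal)}

/-- The points of `Ω` with the same value as `xb`. -/
def sameValue (Ω : Set X) (f : X → Y) (xb : X) : Set X := {x ∈ Ω | f x = f xb}

end Optimization

end BPScal

open BPScal

namespace BPScal

section Cones

variable {Y : Type*} [AddCommGroup Y] [Module ℝ Y]

/-! Since `0` lies off the closed convex base of `-K`, some functional satisfies `xs ≥ δ‖·‖` on `K`
(`exists_dual_ge_norm`). Compactness upgrades `A ∩ (-K) = {0}` to a positive angle, `ρ‖u‖ ≤ ‖a + u‖`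
for `a ∈ A`, `u ∈ K` (`exists_angle_of_isCompact`, `exists_angle_of_isWeaklyCompact`). A new norm
`p`, equal to `xs` on `K`, is then built so that the Bishop–Phelps cone `C` with `α` slightly below
1 contains `K` but hugs it so closely that `-C` meets `A` only in `0` (`exists_bpCone_of_angle`). As
`f[Ω] - f xb ⊆ A`, `xb` is efficient for `C`. The scalarizations use only that `C` is a closed
convex cone: each sublevel condition says `f xb - f x` plus a multiple of `k` lies in `C`, and
`eq_of_smul_add_sub_mem_bpCone` forbids any value below that of `xb`. -/

theorem IsCone.smul_mem {K : Set Y} (hK : IsCone K) {t : ℝ} (ht : 0 ≤ t) {y : Y} (hy : y ∈ K) :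
    t • y ∈ K := by
  rw [← hK.2]
  exact Set.smul_mem_smul ht hy

end Cones

theorem IsNegRepresenting.nonpos_iff {Y : Type*} [AddCommGroup Y] {φ : Y → ℝ} {C : Set Y} (h : IsNegRepresenting φ C)
    (y : Y) :
    φ y ≤ 0 ↔ -y ∈ C := by
  change y ∈ {y | φ y ≤ 0} ↔ _
  rw [← h, Set.mem_neg]

/-! ### Scalarization by a Bishop–Phelps cone -/

section Scalarization

variable {X Y : Type*} [NormedAddCommGroup Y] [NormedSpace ℝ Y]

theorem smul_mem_bpCone {p : Seminorm ℝ Y} {xs : StrongDual ℝ Y} {α t : ℝ} (ht : 0 ≤ t) {y : Y}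
    (hy : y ∈ bpCone p xs α) : t • y ∈ bpCone p xs α := by
  simp only [bpCone, Set.mem_ofPred_eq, map_smul_eq_mul, map_smul, smul_eq_mul,
    Real.norm_of_nonneg ht] at hy ⊢
  nlinarith [mul_le_mul_of_nonneg_left hy ht]

theorem add_mem_bpCone {p : Seminorm ℝ Y} {xs : StrongDual ℝ Y} {α : ℝ} (hα : 0 ≤ α) {y z : Y}
    (hy : y ∈ bpCone p xs α) (hz : z ∈ bpCone p xs α) : y + z ∈ bpCone p xs α := by
  simp only [bpCone, Set.mem_ofPred_eq, map_add] at hy hz ⊢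
  nlinarith [mul_le_mul_of_nonneg_left (map_add_le_add p y z) hα]

theorem zero_mem_bpCone (p : Seminorm ℝ Y) (xs : StrongDual ℝ Y) (α : ℝ) :
    (0 : Y) ∈ bpCone p xs α := by
  simp [bpCone]

theorem IsEquivalentNorm.continuous {p : Seminorm ℝ Y} (hp : IsEquivalentNorm p) :
    Continuous p := by
  obtain ⟨c, C, -, -, h⟩ := hp
  refine Seminorm.continuous_of_continuousAt_zero ?_
  rw [ContinuousAt, map_zero]
  refine squeeze_zero (fun y => apply_nonneg p y) (fun y => (h y).2) ?_
  have : Continuous fun y : Y => C * ‖y‖ := by fun_prop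
  simpa using this.tendsto 0

theorem IsEquivalentNorm.eq_zero {p : Seminorm ℝ Y} (hp : IsEquivalentNorm p) {y : Y}
    (hy : p y ≤ 0) : y = 0 := by
  obtain ⟨c, C, hc, -, h⟩ := hp
  have h1 : c * ‖y‖ ≤ 0 := (h y).1.trans hy
  exact norm_le_zero_iff.1 (nonpos_of_mul_nonpos_right h1 hc)

theorem isClosed_bpCone {p : Seminorm ℝ Y} (hp : IsEquivalentNorm p) (xs : StrongDual ℝ Y)
    (α : ℝ) : IsClosed (bpCone p xs α) :=
  isClosed_le (continuous_const.mul hp.continuous) xs.continuous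

/-- A point of `Ω` dominated by `xb` up to a nonpositive multiple of `k` has the value of `xb`, and
the multiple vanishes. -/
theorem eq_of_smul_add_sub_mem_bpCone {p : Seminorm ℝ Y}
    {xs : StrongDual ℝ Y} {α : ℝ} (hα : 0 < α) {Ω : Set X} {f : X → Y} {xb : X}
    (hxb : xb ∈ Eff Ω f (bpCone p xs α)) {k : Y}
    (hk : k ∈ bpCone p xs α \ lineality (bpCone p xs α)) {x : X} (hx : x ∈ Ω) {t : ℝ}
    (ht : t ≤ 0) (h : t • k + f xb - f x ∈ bpCone p xs α) : t = 0 ∧ f x = f xb := by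
  have hsub : f xb - f x ∈ bpCone p xs α := by
    have h1 := add_mem_bpCone hα.le h (smul_mem_bpCone (neg_nonneg.2 ht) hk.1)
    have h2 : t • k + f xb - f x + (-t) • k = f xb - f x := by module
    rwa [h2] at h1
  have hfx : f x = f xb := by
    by_contra hne
    exact hxb.2 ⟨x, hx, hsub, fun h0 => hne (sub_eq_zero.1 h0).symm⟩
  refine ⟨?_, hfx⟩
  by_contra hne
  -- With `f x = f xb` the hypothesis reads `t • k ∈ C`; a negative `t` would give `-k ∈ C`, so `k`
  -- would be in the lineality space.
  have ht' : t < 0 := lt_of_le_of_ne ht hne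
  have h1 := smul_mem_bpCone (inv_nonneg.2 (neg_nonneg.2 ht)) h
  have h2 : (-t)⁻¹ • (t • k + f xb - f x) = -k := by
    rw [hfx, add_sub_cancel_right, smul_smul, inv_neg, neg_mul, inv_mul_cancel₀ hne, neg_one_smul]
  rw [h2] at h1
  exact hk.2 ⟨hk.1, h1⟩

/-- Writing `a = f xb - s • k` shifts the level by `s`, so every reference point on the line through
`f xb` along `k` reduces to the case `a = f xb`. -/
theorem psSolutions_eq_sameValue {p : Seminorm ℝ Y}
    {xs : StrongDual ℝ Y} {α : ℝ} (hα : 0 < α) {Ω : Set X} {f : X → Y} {xb : X}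
    (hxb : xb ∈ Eff Ω f (bpCone p xs α)) {k : Y}
    (hk : k ∈ bpCone p xs α \ lineality (bpCone p xs α)) {φ : Y → ℝ}
    (hφ : IsNegRepresenting φ (bpCone p xs α)) {a : Y} {s : ℝ} (ha : a + s • k = f xb) :
    psSolutions Ω f φ a k = sameValue Ω f xb ×ˢ {s} := by
  have hfeas : ∀ (x : X) (l : ℝ), (x, l) ∈ psFeasible Ω f φ a k ↔
      x ∈ Ω ∧ (l - s) • k + f xb - f x ∈ bpCone p xs α := by
    intro x l
    have h : -(f x - a - l • k) = (l - s) • k + f xb - f x := by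
      rw [← ha]; module
    simp only [psFeasible, Set.mem_ofPred_eq, hφ.nonpos_iff, h]
  have hval : ∀ x ∈ sameValue Ω f xb, (x, s) ∈ psFeasible Ω f φ a k := fun x hx =>
    (hfeas x s).2 ⟨hx.1, by simp [hx.2, zero_mem_bpCone]⟩
  have hlow : ∀ q ∈ psFeasible Ω f φ a k, q.2 ≤ s → q.2 = s ∧ f q.1 = f xb := by
    rintro ⟨x, l⟩ hq hl
    obtain ⟨hx, hm⟩ := (hfeas x l).1 hq
    obtain ⟨h1, h2⟩ := eq_of_smul_add_sub_mem_bpCone hα hxb hk hx (sub_nonpos.2 hl) hm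
    exact ⟨sub_eq_zero.1 h1, h2⟩
  ext ⟨x, l⟩
  simp only [Set.mem_prod, Set.mem_singleton_iff]
  constructor
  · rintro ⟨hq, hmin⟩
    obtain ⟨h1, h2⟩ := hlow _ hq (hmin _ (hval xb ⟨hxb.1, rfl⟩))
    exact ⟨⟨hq.1, h2⟩, h1⟩
  · rintro ⟨hx, rfl⟩
    refine ⟨hval x hx, fun q hq => ?_⟩
    by_contra! hlt
    exact hlt.ne (hlow q hq hlt.le).1

theorem sameValue_eq_argmin {p : Seminorm ℝ Y} {xs : StrongDual ℝ Y} {α : ℝ}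
    {Ω : Set X} {f : X → Y} {xb : X}
    (hxb : xb ∈ Eff Ω f (bpCone p xs α)) {φ : Y → ℝ} (hφ0 : φ 0 = 0)
    (hφ : IsNegRepresenting φ (bpCone p xs α)) :
    sameValue Ω f xb = argmin Ω (fun x => φ (f x - f xb)) := by
  have hpos : ∀ x ∈ Ω, φ (f x - f xb) ≤ 0 → f x = f xb := by
    intro x hx h
    rw [hφ.nonpos_iff, neg_sub] at h
    by_contra hne
    exact hxb.2 ⟨x, hx, h, fun h0 => hne (sub_eq_zero.1 h0).symm⟩
  ext x
  constructor
  · rintro ⟨hx, hfx⟩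
    refine ⟨hx, fun x' hx' => ?_⟩
    simp only [hfx, sub_self, hφ0]
    by_contra! hlt
    have := hpos x' hx' hlt.le
    simp [this, hφ0] at hlt
  · rintro ⟨hx, hmin⟩
    refine ⟨hx, hpos x hx ?_⟩
    simpa [hφ0] using hmin xb hxb.1

theorem gerstewitz_eq_and_sameValue_eq_argmin {p : Seminorm ℝ Y} (hp : IsEquivalentNorm p)
    {xs : StrongDual ℝ Y} {α : ℝ} (hα : 0 < α) {Ω : Set X} {f : X → Y} {xb : X}
    (hxb : xb ∈ Eff Ω f (bpCone p xs α)) {k : Y}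
    (hk : k ∈ bpCone p xs α \ lineality (bpCone p xs α)) {a : Y} {s : ℝ}
    (ha : a + s • k = f xb) :
    gerstewitz a (bpCone p xs α) k (f xb) = (s : EReal) ∧
      sameValue Ω f xb = argmin Ω (fun x => gerstewitz a (bpCone p xs α) k (f x)) := by
  have hshift : ∀ (x : X) (t : ℝ), t • k + a - f x = (t - s) • k + f xb - f x := by
    intro x t
    rw [← ha]; module
  have hlow : ∀ x ∈ Ω, (s : EReal) ≤ gerstewitz a (bpCone p xs α) k (f x) := by
    intro x hx
    refine le_sInf ?_
    rintro _ ⟨t, ht, rfl⟩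
    rw [hshift] at ht
    by_contra! hlt
    have hts : t < s := EReal.coe_lt_coe_iff.1 hlt
    have := (eq_of_smul_add_sub_mem_bpCone hα hxb hk hx (sub_nonpos.2 hts.le) ht).1
    linarith
  have hval : gerstewitz a (bpCone p xs α) k (f xb) = (s : EReal) := by
    refine le_antisymm (sInf_le ⟨s, ?_, rfl⟩) (hlow xb hxb.1)
    rw [hshift]
    simp [zero_mem_bpCone]
  refine ⟨hval, ?_⟩
  ext x
  constructor
  · rintro ⟨hx, hfx⟩
    refine ⟨hx, fun x' hx' => ?_⟩
    simp only [hfx, hval]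
    exact hlow x' hx'
  · rintro ⟨hx, hmin⟩
    have hle : gerstewitz a (bpCone p xs α) k (f x) ≤ s := hval ▸ hmin xb hxb.1
    -- The infimum is not known to be attained at `f x`. Since `C + ℝ₊ k ⊆ C`, every level above `s`
    -- is admissible, and closedness of `C` allows `l → 0`.
    have hmem : ∀ l : ℝ, 0 < l → l • k + f xb - f x ∈ bpCone p xs α := by
      intro l hl
      have hlt : gerstewitz a (bpCone p xs α) k (f x) < ((s + l : ℝ) : EReal) :=
        hle.trans_lt (EReal.coe_lt_coe_iff.2 (by linarith))
      obtain ⟨_, ⟨t, ht, rfl⟩, htl⟩ := sInf_lt_iff.1 hlt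
      rw [hshift] at ht
      have htl' : t < s + l := EReal.coe_lt_coe_iff.1 htl
      have h := add_mem_bpCone hα.le ht
        (smul_mem_bpCone (t := s + l - t) (by linarith) hk.1)
      have h2 : (t - s) • k + f xb - f x + (s + l - t) • k = l • k + f xb - f x := by module
      rwa [h2] at h
    have hlim : (0 : ℝ) • k + f xb - f x ∈ bpCone p xs α := by
      have hc : Continuous fun l : ℝ => l • k + f xb - f x := by fun_prop
      refine (isClosed_bpCone hp xs α).mem_of_tendsto
        ((hc.tendsto 0).mono_left (nhdsWithin_le_nhds (s := Set.Ioi 0))) ?_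
      filter_upwards [self_mem_nhdsWithin] with l hl using hmem l hl
    exact ⟨hx, (eq_of_smul_add_sub_mem_bpCone hα hxb hk hx le_rfl hlim).2⟩

end Scalarization

/-! ### Separation of cones and renorming -/

section Separation

variable {Y : Type*} [NormedAddCommGroup Y] [NormedSpace ℝ Y]

/-- Hahn–Banach gives `g < u < 0` on the base of `-K`; evaluating at `-y/‖y‖` yields `δ = -u`. -/
theorem exists_dual_ge_norm {K : Set Y} (hK : IsCone K)
    (hK0 : (0 : Y) ∉ closure (convBase (-K) (normSeminorm ℝ Y))) :
    ∃ (xs : StrongDual ℝ Y) (δ : ℝ), 0 < δ ∧ ∀ y ∈ K, δ * ‖y‖ ≤ xs y := by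
  obtain ⟨g, u, hu, h0⟩ := geometric_hahn_banach_closed_point
    (convex_convexHull ℝ _).closure isClosed_closure hK0
  rw [map_zero] at h0
  refine ⟨g, -u, by linarith, fun y hy => ?_⟩
  rcases eq_or_ne y 0 with rfl | hne
  · simp
  have hn : 0 < ‖y‖ := norm_pos_iff.2 hne
  have h1 : -(‖y‖⁻¹ • y) ∈ normBase (-K) (normSeminorm ℝ Y) := by
    refine ⟨by simpa using hK.smul_mem (inv_nonneg.2 hn.le) hy, ?_⟩
    simp [norm_smul, hn.ne']
  have h2 := hu _ (subset_closure (subset_convexHull ℝ _ h1))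
  rw [map_neg, map_smul, smul_eq_mul, neg_lt, inv_mul_eq_div, lt_div_iff₀ hn] at h2
  exact h2.le

/-- The dilating construction: a cone `A` at positive angle to `-K` is separated from `-K` by a
Bishop–Phelps cone of an equivalent norm. -/
theorem exists_bpCone_of_angle {K A : Set Y} (hK : IsCone K) (hKconv : Convex ℝ K)
    {xs : StrongDual ℝ Y} {δ : ℝ} (hδ : 0 < δ) (hxs : ∀ y ∈ K, δ * ‖y‖ ≤ xs y)
    {ρ : ℝ} (hρ : 0 < ρ) (hangle : ∀ a ∈ A, ∀ u ∈ K, ρ * ‖u‖ ≤ ‖a + u‖) :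
    ∃ p : Seminorm ℝ Y, IsEquivalentNorm p ∧ ∃ α : ℝ, 0 < α ∧
      (xs, α) ∈ augQuasiDual K p ∧ ∀ y ∈ bpCone p xs α, -y ∈ A → y = 0 := by
  have hxs0 : ∀ y ∈ K, 0 ≤ xs y := fun y hy => (by positivity : 0 ≤ δ * ‖y‖).trans (hxs y hy)
  set N := ‖xs‖ with hN
  have hN0 : 0 ≤ N := norm_nonneg _
  -- `U` is the open unit ball of the norm `p y = inf (xs u + xs v + (N + 1) * ‖y - u + v‖)` over
  -- `u, v ∈ K`. In the weight, `N` absorbs `xs` of the error term and the extra 1 keeps control of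
  -- its norm.
  set U : Set Y := {y | ∃ u ∈ K, ∃ v ∈ K, xs u + xs v + (N + 1) * ‖y - u + v‖ < 1} with hU
  have hUconv : Convex ℝ U := by
    rintro y ⟨u, hu, v, hv, h⟩ y' ⟨u', hu', v', hv', h'⟩ a b ha hb hab
    refine ⟨a • u + b • u', hKconv hu hu' ha hb hab, a • v + b • v', hKconv hv hv' ha hb hab, ?_⟩
    have he : a • y + b • y' - (a • u + b • u') + (a • v + b • v') =
        a • (y - u + v) + b • (y' - u' + v') := by module
    have hn : ‖a • (y - u + v) + b • (y' - u' + v')‖ ≤ a * ‖y - u + v‖ + b * ‖y' - u' + v'‖ := by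
      refine (norm_add_le _ _).trans_eq ?_
      rw [norm_smul, norm_smul, Real.norm_of_nonneg ha, Real.norm_of_nonneg hb]
    rw [he]
    simp only [map_add, map_smul, smul_eq_mul]
    have h1 := mul_le_mul_of_nonneg_left hn (by positivity : 0 ≤ N + 1)
    have h2 := (convex_Iio (𝕜 := ℝ) (1 : ℝ)) h h' ha hb hab
    simp only [smul_eq_mul, Set.mem_Iio] at h2
    linarith
  have hUneg : ∀ y ∈ U, -y ∈ U := by
    rintro y ⟨u, hu, v, hv, h⟩
    refine ⟨v, hv, u, hu, ?_⟩
    have he : -y - v + u = -(y - u + v) := by abel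
    rw [he, norm_neg]
    linarith
  have hU0 : (0 : Y) ∈ U := ⟨0, hK.1, 0, hK.1, by simp⟩
  have hUbal : Balanced ℝ U := by
    rw [balanced_iff_smul_mem]
    intro r hr y hy
    rcases le_total 0 r with h0 | h0
    · exact hUconv.smul_mem_of_zero_mem hU0 hy ⟨h0, by rwa [Real.norm_of_nonneg h0] at hr⟩
    · rw [← neg_smul_neg]
      exact hUconv.smul_mem_of_zero_mem hU0 (hUneg y hy)
        ⟨neg_nonneg.2 h0, by rwa [Real.norm_of_nonpos h0] at hr⟩
  have hUnhds : U ∈ nhds (0 : Y) := by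
    refine Metric.mem_nhds_iff.2 ⟨(N + 1)⁻¹, by positivity, fun y hy => ?_⟩
    rw [mem_ball_zero_iff, ← mul_lt_mul_iff_right₀ (by positivity : 0 < N + 1),
      mul_inv_cancel₀ (by positivity)] at hy
    exact ⟨0, hK.1, 0, hK.1, by simpa using hy⟩
  have hUabs : Absorbent ℝ U := absorbent_nhds_zero hUnhds
  set p : Seminorm ℝ Y := gaugeSeminorm hUbal hUconv hUabs with hp
  have hple : ∀ (y u v : Y) (r : ℝ), u ∈ K → v ∈ K → 0 < r →
      xs u + xs v + (N + 1) * ‖y - u + v‖ < r → p y ≤ r := by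
    intro y u v r hu hv hr h
    refine gauge_le_of_mem hr.le ⟨r⁻¹ • y, ?_, by simp [smul_smul, hr.ne']⟩
    refine ⟨r⁻¹ • u, hK.smul_mem (by positivity) hu, r⁻¹ • v, hK.smul_mem (by positivity) hv, ?_⟩
    rw [← smul_sub, ← smul_add, norm_smul, map_smul, map_smul, Real.norm_of_nonneg (by positivity),
      smul_eq_mul, smul_eq_mul]
    have h1 := mul_lt_mul_of_pos_left h (inv_pos.2 hr)
    rw [inv_mul_cancel₀ hr.ne'] at h1
    linarith
  have hplt : ∀ (y : Y) (r : ℝ), p y < r →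
      ∃ u ∈ K, ∃ v ∈ K, xs u + xs v + (N + 1) * ‖y - u + v‖ < r := by
    intro y r hr
    obtain ⟨b, hb, hbr, y', ⟨u, hu, v, hv, h⟩, rfl⟩ := exists_lt_of_gauge_lt hUabs hr
    refine ⟨b • u, hK.smul_mem hb.le hu, b • v, hK.smul_mem hb.le hv, ?_⟩
    simp only
    rw [← smul_sub, ← smul_add, norm_smul, map_smul, map_smul, Real.norm_of_nonneg hb.le,
      smul_eq_mul, smul_eq_mul]
    have h1 := mul_lt_mul_of_pos_left h hb
    linarith
  have hpK : ∀ y ∈ K, p y ≤ xs y := by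
    intro y hy
    refine le_of_forall_gt_imp_ge_of_dense fun r hr => ?_
    exact hple y y 0 r hy hK.1 ((hxs0 y hy).trans_lt hr) (by simpa using hr)
  have hxsn : ∀ y, xs y ≤ N * ‖y‖ := fun y => (le_abs_self _).trans (xs.le_opNorm y)
  have hnv : ∀ v ∈ K, ‖v‖ ≤ δ⁻¹ * xs v := fun v hv => by
    rw [inv_mul_eq_div, le_div_iff₀ hδ, mul_comm]; exact hxs v hv
  have hequiv : IsEquivalentNorm p := by
    refine ⟨(δ⁻¹ + 1)⁻¹, N + 1, by positivity, by positivity, fun y => ⟨?_, ?_⟩⟩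
    · refine le_of_forall_gt_imp_ge_of_dense fun r hr => ?_
      obtain ⟨u, hu, v, hv, h⟩ := hplt y r hr
      rw [inv_mul_eq_div, div_le_iff₀ (by positivity)]
      -- The lower bound on `p` rests on `‖u‖ ≤ δ⁻¹ * xs u` on `K`: without it the cone terms could
      -- be large in norm at little cost.
      have h1 : ‖y‖ ≤ ‖u‖ + ‖v‖ + ‖y - u + v‖ := by
        have : y = u - v + (y - u + v) := by abel
        calc ‖y‖ = ‖u - v + (y - u + v)‖ := by rw [← this]
          _ ≤ _ := (norm_add_le _ _).trans (by gcongr; exact norm_sub_le _ _)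
      have h2 : ‖y - u + v‖ ≤ r := by
        nlinarith [hxs0 u hu, hxs0 v hv, mul_nonneg hN0 (norm_nonneg (y - u + v))]
      have h3 : xs u + xs v ≤ r := by
        nlinarith [mul_nonneg (by positivity : 0 ≤ N + 1) (norm_nonneg (y - u + v))]
      have h4 := mul_le_mul_of_nonneg_left h3 (inv_nonneg.2 hδ.le)
      linarith [hnv u hu, hnv v hv]
    · refine le_of_forall_gt_imp_ge_of_dense fun r hr => ?_
      exact hple y 0 0 r hK.1 hK.1 ((by positivity : 0 ≤ (N + 1) * ‖y‖).trans_lt hr)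
        (by simpa using hr)
  -- `t` is the gap `1 - α`
  obtain ⟨t, ht0, ht1, ht2⟩ : ∃ t : ℝ, 0 < t ∧ t ≤ 1 / 2 ∧
      2 * t * (N * (δ⁻¹ + 1) + ρ * N) < ρ * (1 / 2) := by
    set Q := N * (δ⁻¹ + 1) + ρ * N with hQ
    have hQ0 : 0 ≤ Q := by positivity
    refine ⟨min (1 / 2) (ρ / (8 * (Q + 1))), by positivity, min_le_left _ _, ?_⟩
    have h1 : min (1 / 2) (ρ / (8 * (Q + 1))) ≤ ρ / (8 * (Q + 1)) := min_le_right _ _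
    rw [le_div_iff₀ (by positivity)] at h1
    have h2 : 0 < min (1 / 2) (ρ / (8 * (Q + 1))) := by positivity
    nlinarith
  refine ⟨p, hequiv, 1 - t, by linarith, ⟨fun y hy => ?_, by simp only; linarith, fun y hy => ?_⟩,
    fun y hy hyA => ?_⟩
  · exact (mul_pos hδ (norm_pos_iff.2 hy.2)).trans_le (hxs y hy.1)
  · have h1 : 0 < xs y := (mul_pos hδ (norm_pos_iff.2 hy.2)).trans_le (hxs y hy.1)
    simp only
    nlinarith [hpK y hy.1]
  · by_contra hne
    have hp0 : 0 < p y := by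
      by_contra! h
      exact hne (hequiv.eq_zero h)
    obtain ⟨u, hu, v, hv, h⟩ := hplt y ((1 + t) * p y) (by nlinarith)
    have hy' : (1 - t) * p y ≤ xs y := hy
    set e := y - u + v with he
    have hxy : xs y = xs u - xs v + xs e := by simp [he]
    have he1 := hxsn e
    -- Near-optimality bounds `xs u + xs v + (N + 1) * ‖e‖` by `(1 + t) * p y`, while `xs u - xs v +
    -- xs e ≥ (1 - t) * p y`; subtracting leaves a gap of `2 * t * p y`. So `y` is within `O(t) * p
    -- y` of `u ∈ K`, whereas `N * ‖u‖` stays near `p y`, contradicting the angle when `-y ∈ A`.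
    have hsmall : 2 * xs v + ‖e‖ ≤ 2 * t * p y := by linarith
    have hv0 := hxs0 v hv
    have hyu : ‖-y + u‖ ≤ (δ⁻¹ + 1) * (2 * t * p y) := by
      have : -y + u = v - e := by rw [he]; abel
      rw [this]
      have h1 := norm_sub_le v e
      have h2 : δ⁻¹ * xs v ≤ δ⁻¹ * (2 * t * p y) :=
        mul_le_mul_of_nonneg_left (by linarith [norm_nonneg e]) (by positivity)
      linarith [hnv v hv]
    have hang := (hangle (-y) hyA u hu).trans hyu
    have hNe : N * ‖e‖ ≤ N * (2 * t * p y) := mul_le_mul_of_nonneg_left (by linarith) hN0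
    have hu1 : (1 - t) * p y - N * (2 * t * p y) ≤ N * ‖u‖ := by linarith [hxsn u]
    have h3 := mul_le_mul_of_nonneg_left hu1 hρ.le
    have h4 := mul_le_mul_of_nonneg_left hang hN0
    have h5 : ρ * (1 / 2) * p y ≤ ρ * ((1 - t) * p y) := by
      nlinarith [mul_pos hρ hp0]
    have h6 := mul_lt_mul_of_pos_right ht2 hp0
    nlinarith

/-- A cone with compact unit base that meets `-K` only in `0` is at positive angle to `-K`. -/
theorem exists_angle_of_isCompact {K A : Set Y} (hK : IsCone K) (hKclosed : IsClosed K)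
    (hA : IsCone A) (hAK : A ∩ (-K) = {0}) (hc : IsCompact (normBase A (normSeminorm ℝ Y))) :
    ∃ ρ : ℝ, 0 < ρ ∧ ∀ a ∈ A, ∀ u ∈ K, ρ * ‖u‖ ≤ ‖a + u‖ := by
  have hdisj : Disjoint (normBase A (normSeminorm ℝ Y)) (-K) := by
    rw [Set.disjoint_left]
    rintro a ⟨haA, han⟩ haK
    have h0 : a ∈ ({0} : Set Y) := hAK ▸ ⟨haA, haK⟩
    rw [Set.mem_singleton_iff.1 h0] at han
    simp at han
  obtain ⟨r, hr, hrd⟩ := Metric.exists_pos_forall_lt_edist hc hKclosed.neg hdisj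
  have hr' : (0 : ℝ) < r := hr
  have hbase : ∀ a ∈ A, ∀ u ∈ K, r * ‖a‖ ≤ ‖a + u‖ := by
    intro a ha u hu
    rcases eq_or_ne a 0 with rfl | hne
    · simp
    have hn : 0 < ‖a‖ := norm_pos_iff.2 hne
    have h1 := hrd (‖a‖⁻¹ • a) ⟨hA.smul_mem (by positivity) ha, by simp [norm_smul, hn.ne']⟩
      (-(‖a‖⁻¹ • u)) (by simpa using hK.smul_mem (by positivity) hu)
    rw [edist_nndist, ENNReal.coe_lt_coe, ← NNReal.coe_lt_coe, coe_nndist, dist_eq_norm,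
      sub_neg_eq_add, ← smul_add, norm_smul, norm_inv, norm_norm, inv_mul_eq_div,
      lt_div_iff₀ hn] at h1
    exact h1.le
  -- The triangle inequality trades the bound by `‖a‖` for one by `‖u‖`, which explains the
  -- constant.
  refine ⟨r / (1 + r), by positivity, fun a ha u hu => ?_⟩
  have h1 := hbase a ha u hu
  have h2 : ‖u‖ ≤ ‖a + u‖ + ‖a‖ := by
    have := norm_sub_le (a + u) a
    simpa using this
  rw [div_mul_eq_mul_div, div_le_iff₀ (by positivity)]
  nlinarith

/-- A weakly closed set minus a weakly compact one is weakly closed, hence norm closed. So `A - S`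
misses a ball of radius `ρ` about `0`, and it contains `(a + u)/‖u‖`. -/
theorem exists_angle_of_isWeaklyCompact {K A : Set Y} (hK : IsCone K) (hKclosed : IsClosed K)
    (hKconv : Convex ℝ K) (hK0 : (0 : Y) ∉ closure (convBase (-K) (normSeminorm ℝ Y)))
    (hA : IsCone A) (hAK : A ∩ (-K) = {0}) (hAw : IsWeaklyClosed A)
    (hc : IsWeaklyCompact (closure (convBase (-K) (normSeminorm ℝ Y)))) :
    ∃ ρ : ℝ, 0 < ρ ∧ ∀ a ∈ A, ∀ u ∈ K, ρ * ‖u‖ ≤ ‖a + u‖ := by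
  set S := closure (convBase (-K) (normSeminorm ℝ Y)) with hS
  have hSK : S ⊆ -K := closure_minimal
    (convexHull_min (fun y hy => hy.1) hKconv.neg) hKclosed.neg
  have hclosed : IsClosed (A - S) := by
    have h1 : IsClosed (toWeakSpace ℝ Y '' A + -(toWeakSpace ℝ Y '' S)) :=
      hAw.add_right_of_isCompact hc.neg
    have h2 : A - S = toWeakSpaceCLM ℝ Y ⁻¹' (toWeakSpace ℝ Y '' A + -(toWeakSpace ℝ Y '' S)) := by
      rw [← sub_eq_add_neg, ← Set.image_sub]
      exact (Set.preimage_image_eq _ (toWeakSpace ℝ Y).injective).symm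
    rw [h2]
    exact h1.preimage (toWeakSpaceCLM ℝ Y).continuous
  have h0 : (0 : Y) ∉ A - S := by
    rintro ⟨a, ha, s, hs, has⟩
    obtain rfl : a = s := sub_eq_zero.1 has
    have : a ∈ ({0} : Set Y) := hAK ▸ ⟨ha, hSK hs⟩
    rw [Set.mem_singleton_iff.1 this] at hs
    exact hK0 hs
  obtain ⟨ρ, hρ, hball⟩ := Metric.isOpen_iff.1 hclosed.isOpen_compl 0 h0
  refine ⟨ρ, hρ, fun a ha u hu => ?_⟩
  rcases eq_or_ne u 0 with rfl | hne
  · simp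
  have hn : 0 < ‖u‖ := norm_pos_iff.2 hne
  have hmem : -(‖u‖⁻¹ • u) ∈ S := by
    refine subset_closure (subset_convexHull ℝ _ ⟨?_, ?_⟩)
    · simpa using hK.smul_mem (by positivity) hu
    · simp [norm_smul, hn.ne']
  have h1 : ‖u‖⁻¹ • (a + u) ∈ A - S :=
    ⟨‖u‖⁻¹ • a, hA.smul_mem (by positivity) ha, _, hmem, by simp [smul_add]⟩
  by_contra! hlt
  refine hball ?_ h1
  rwa [mem_ball_zero_iff, norm_smul, norm_inv, norm_norm, inv_mul_eq_div, div_lt_iff₀ hn]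

theorem IsReflexive.isWeaklyCompact_closure (hY : IsReflexive Y) {S : Set Y} (hS : Convex ℝ S)
    (hb : Bornology.IsBounded S) : IsWeaklyCompact (closure S) := by
  -- Convexity makes the norm closure and the weak closure coincide.
  rw [IsWeaklyCompact, hS.toWeakSpace_closure ℝ]
  refine NormedSpace.isCompact_closure_of_isBounded ℝ Y _ ?_ ?_
  · rwa [Set.preimage_image_eq _ (toWeakSpace ℝ Y).injective]
  · intro y _
    obtain ⟨x, hx⟩ := hY (WeakDual.toStrongDual y)
    exact ⟨toWeakSpace ℝ Y x, DFunLike.ext _ _ fun z => congrArg (fun F => F z) hx⟩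

theorem isBounded_convBase (K : Set Y) : Bornology.IsBounded (convBase K (normSeminorm ℝ Y)) := by
  refine (Metric.isBounded_closedBall (x := (0 : Y)) (r := 1)).subset
    (convexHull_min (fun y hy => ?_) (convex_closedBall 0 1))
  simpa using hy.2.le

end Separation

end BPScal

/-! ### Assembly of the main theorem -/

theorem mainTheorem11 {X Y : Type*} [NormedAddCommGroup Y] [NormedSpace ℝ Y]
    (hdim : 2 ≤ Module.rank ℝ Y)
    (Ω : Set X) (f : X → Y)
    (K : Set Y) (hK : IsNontrivialCone K) (hKclosed : IsClosed K) (hKconv : Convex ℝ K)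
    (hK0 : (0 : Y) ∉ closure (convBase (-K) (normSeminorm ℝ Y)))
    (𝔸 : X → Set Y) (h𝔸 : ∀ x ∈ Ω, IsCone (𝔸 x))
    (xb : X) (hxb : xb ∈ PEff 𝔸 Ω f K)
    (hne : (fun x => f x - f xb) '' Ω ≠ {0})
    (hsub : (fun x => f x - f xb) '' Ω ⊆ 𝔸 xb)
    (hcond :
      (IsCompact (normBase (𝔸 xb) (normSeminorm ℝ Y)) ∧
        IsCompact (closure (convBase (-K) (normSeminorm ℝ Y)))) ∨
      (IsWeaklyClosed (𝔸 xb) ∧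
        (IsReflexive Y ∨
          (IsWeaklyCompact (closure (convBase (-K) (normSeminorm ℝ Y))) ∧
            IsWeaklyCompact (weakClosure (normBase (𝔸 xb) (normSeminorm ℝ Y))) ∧
            (0 : Y) ∉ weakClosure (normBase (𝔸 xb) (normSeminorm ℝ Y)))))) :
    ∃ p : Seminorm ℝ Y, IsEquivalentNorm p ∧
      ∃ (xs : StrongDual ℝ Y) (α : ℝ), (xs, α) ∈ augQuasiDual K p ∧ 0 < α ∧
        xb ∈ Eff Ω f (bpCone p xs α) ∧
        ∀ φ : Y → ℝ, IsSublinear φ → φ 0 = 0 → IsNegRepresenting φ (bpCone p xs α) →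
          (∀ k ∈ bpCone p xs α \ lineality (bpCone p xs α),
            psSolutions Ω f φ (f xb) k = sameValue Ω f xb ×ˢ {(0 : ℝ)}) ∧
          sameValue Ω f xb = argmin Ω (fun x => φ (f x - f xb)) ∧
          ∀ (P T : Set Y) (R : Set ℝ),
            T ⊆ bpCone p xs α \ lineality (bpCone p xs α) →
            f '' Eff Ω f (bpCone p xs α) ⊆ P + R • T →
            (∃ a ∈ P, ∃ k ∈ T, ∃ s ∈ R,
              psSolutions Ω f φ a k = sameValue Ω f xb ×ˢ {s}) ∧
            (∃ a ∈ P, ∃ k ∈ T, ∃ s ∈ R,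
              gerstewitz a (bpCone p xs α) k (f xb) = (s : EReal) ∧
              sameValue Ω f xb =
                argmin Ω (fun x => gerstewitz a (bpCone p xs α) k (f x))) := by
  have hA : IsCone (𝔸 xb) := h𝔸 xb hxb.1.1
  obtain ⟨xs, δ, hδ, hxs⟩ := exists_dual_ge_norm hK.1 hK0
  obtain ⟨ρ, hρ, hangle⟩ : ∃ ρ : ℝ, 0 < ρ ∧ ∀ a ∈ 𝔸 xb, ∀ u ∈ K, ρ * ‖u‖ ≤ ‖a + u‖ := by
    rcases hcond with ⟨hc, -⟩ | ⟨hAw, hY | ⟨hc, -, -⟩⟩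
    · exact exists_angle_of_isCompact hK.1 hKclosed hA hxb.2 hc
    · exact exists_angle_of_isWeaklyCompact hK.1 hKclosed hKconv hK0 hA hxb.2 hAw
        (hY.isWeaklyCompact_closure (convex_convexHull ℝ _) (isBounded_convBase _))
    · exact exists_angle_of_isWeaklyCompact hK.1 hKclosed hKconv hK0 hA hxb.2 hAw hc
  obtain ⟨p, hp, α, hα, haug, hsep⟩ := exists_bpCone_of_angle hK.1 hKconv hδ hxs hρ hangle
  have hEff : xb ∈ Eff Ω f (bpCone p xs α) := by
    refine ⟨hxb.1.1, ?_⟩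
    rintro ⟨x, hx, hC, hne0⟩
    exact hne0 (hsep _ hC (by rw [neg_sub]; exact hsub ⟨x, hx, rfl⟩))
  refine ⟨p, hp, xs, α, haug, hα, hEff, fun φ _ hφ0 hφ => ⟨fun k hk => ?_,
    sameValue_eq_argmin hEff hφ0 hφ, fun P T R hT hcover => ?_⟩⟩
  · exact psSolutions_eq_sameValue hα hEff hk hφ (by simp)
  · obtain ⟨a, ha, _, ⟨s, hs, k, hk, rfl⟩, hask⟩ := hcover ⟨xb, hEff, rfl⟩
    exact ⟨⟨a, ha, k, hk, s, hs, psSolutions_eq_sameValue hα hEff (hT hk) hφ hask⟩,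
      ⟨a, ha, k, hk, s, hs, gerstewitz_eq_and_sameValue_eq_argmin hp hα hEff (hT hk) hask⟩⟩
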